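/- Let $k\ge 1$ and $n\ge 0$ be integers and put $$P_{k,n}=\Big\{x\in[0,1]^{k(n+1)} : \sum_{i=1}^{k(n+1)}x_i=n+1,\ \ \sum_{s=1}^{kt}x_s\le t\ \text{ for } t=1,\dots,n\Big\}.$$ Its normalized volume is the $(k(n+1)-1)$-dimensional volume in the hyperplane $H=\{\sum_i x_i=n+1\}$, scaled so that a unimodular simplex of the lattice $H\cap\mathbb Z^{k(n+1)}$ has volume $1$; that is, $(k(n+1)-1)!$ times the Lebesgue measure of the projection of $P_{k,n}$ to the first $k(n+1)-1$ coordinates. For a permutation $w=w_1\cdots w_N$ of $\{1,\dots,N\}$, let $\mathrm{ad}(w)$ be the $0/1$ sequence of length $N-1$ (empty if $N=0$) with $\mathrm{ad}(w)_i=0$ if $w_i<w_{i+1}$ and $\mathrm{ad}(w)_i=1$ if $w_i>w_{i+1}$. Let $L(w)$ be the lattice path that starts at $(0,0)$ and whose $i$-th step is $(1,0)$ if $\mathrm{ad}(w)_i=0$ and $(0,1)$ if $\mathrm{ad}(w)_i=1$. Then the normalized volume of $P_{k,n}$ is equal to the number of permutations $w\in S_{kn+k-1}$ such that $L(w)$ is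 a $(k-1)$-Dyck path of height $n$, i.e. $L(w)$ ends at a point with second coordinate $n$ (for $k\ge2$ this endpoint is $((k-1)(n+1)-1,\,n)$) and every point $(x,y)$ of $L(w)$ satisfies $(k-1)y\le x$. Equivalently, the normalized volume of $P_{k,n}$ is equal to the number of permutations $w\in S_{kn+k-1}$ such that $\mathrm{ad}(w)$ contains exactly $n$ ones and is a $(k-1)$-ballot sequence, i.e. every initial string of $\mathrm{ad}(w)$ has at least $k-1$ times as many $0$'s as $1$'s. -/

import Mathlib

open scoped Nat ENNReal

namespace EulerianCatalan

/-- The hypersimplex `Δ(r, N)`: the points of `[0,1]^N` with coordinate sum `r`. -/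
def hypersimplex (r N : ℕ) : Set (Fin N → ℝ) :=
  {x | (∀ i, 0 ≤ x i ∧ x i ≤ 1) ∧ ∑ i, x i = r}

/-- The polytope `P_{k,n}`: the points `x` of `Δ(n+1, k(n+1))` whose first `k t` coordinates have
sum at most `t`, for `t = 1, …, n`. (Coordinates are numbered from `0` here.) -/
def polytopeP (k n : ℕ) : Set (Fin (k * (n + 1)) → ℝ) :=
  {x | x ∈ hypersimplex (n + 1) (k * (n + 1)) ∧
    ∀ t : ℕ, 1 ≤ t → t ≤ n → ∑ i with i.val < k * t, x i ≤ t}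

/-- Forgetting the last of `N` coordinates. -/
def dropLast (N : ℕ) (x : Fin N → ℝ) : Fin (N - 1) → ℝ :=
  fun i => x (Fin.castLE (Nat.sub_le N 1) i)

/-- The normalized volume of a subset `S` of a hyperplane `H = {x ∈ ℝ^N | ∑ x_i = c}`, `c ∈ ℤ`:
the `(N-1)`-dimensional volume on `H` for which unimodular simplices of the lattice `H ∩ ℤ^N` have
volume `1`. Forgetting the last coordinate is an affine isomorphism `H → ℝ^(N-1)` that maps
`H ∩ ℤ^N` onto `ℤ^(N-1)`, and a unimodular simplex of `ℤ^(N-1)` has Lebesgue measure `1/(N-1)!`. -/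
noncomputable def normalizedVolume {N : ℕ} (S : Set (Fin N → ℝ)) : ℝ≥0∞ :=
  ((N - 1)! : ℝ≥0∞) * MeasureTheory.volume (dropLast N '' S)

/-- The ascent/descent vector of a permutation `w = w_1 ⋯ w_N`, of length `N - 1`:
the entry is `0` at an ascent and `1` at a descent. -/
def ad {N : ℕ} (w : Equiv.Perm (Fin N)) : Fin (N - 1) → Fin 2 :=
  fun i => if w ⟨i.val, by omega⟩ < w ⟨i.val + 1, by omega⟩ then 0 else 1

/-- A `0/1` sequence is an `m`-ballot sequence if every initial string has at least `m` times as
many `0`s as `1`s. -/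
def IsBallot (m : ℕ) {l : ℕ} (a : Fin l → Fin 2) : Prop :=
  ∀ j : ℕ, j ≤ l →
    m * (Finset.univ.filter fun i : Fin l => i.val < j ∧ a i = 1).card ≤
      (Finset.univ.filter fun i : Fin l => i.val < j ∧ a i = 0).card

/-- The lattice path `L(w)`, as the sequence of its vertices `p_0, …, p_{N-1}`: it starts at `(0,0)`
and its `i`-th step is `(1,0)` if `w` has an ascent at `i` and `(0,1)` if it has a descent there. -/
def latticePath {N : ℕ} (w : Equiv.Perm (Fin N)) : Fin (N - 1 + 1) → ℕ × ℕ :=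
  fun j => ∑ i : Fin (N - 1) with i.val < j.val,
    if w ⟨i.val, by omega⟩ < w ⟨i.val + 1, by omega⟩ then (1, 0) else (0, 1)

/-- `p_0, …, p_l` is an `m`-Dyck path of height `h`: a lattice path with steps `(1,0)` and `(0,1)`
from `(0,0)` to a point with second coordinate `h`, hence to `(l - h, h)`, all of whose points
satisfy `y ≤ x / m`, written without division as `m y ≤ x`. -/
structure IsDyckPath (m h : ℕ) {l : ℕ} (p : Fin (l + 1) → ℕ × ℕ) : Prop where
  start : p 0 = (0, 0)
  step : ∀ i : Fin l, p i.succ = p i.castSucc + (1, 0) ∨ p i.succ = p i.castSucc + (0, 1)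
  height : (p (Fin.last l)).2 = h
  below : ∀ j, m * (p j).2 ≤ (p j).1

end EulerianCatalan

/-! Forget the last coordinate and put M = kn+k-1. Send a point of the cube to the fractional parts
of its partial sums. Up to a null set this cuts the cube into M! cells, one for each relative order
`w` of the fractional parts. On each cell the map is unimodular up to a translation, so each cell
has volume 1/M! (`factorial_mul_volume_cell`). As each coordinate lies between 0 and 1, the integer
part of the partial sums goes up by one exactly at the descents of `w`
(`floor_partialSum_eq_of_mem_chamber`).

Hence on a cell the defining inequalities depend only on `w`: a total between n and n+1 means n
descents, and the bound t on the first kt coordinates means fewer than t descents among the first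
kt-1 steps. These bounds amount to the ballot condition (`isBallot_iff_of_onesBefore_eq`), so the
polytope is almost everywhere a union of cells (`projectedPolytope_ae_eq`), and counting them gives
the volume. -/

namespace EulerianCatalan

/-! ### Ballot sequences and Dyck paths -/

/-- The number of ones among the first `j` entries of a `0/1` sequence. -/
def onesBefore {l : ℕ} (a : Fin l → Fin 2) (j : ℕ) : ℕ :=
  (Finset.univ.filter fun i : Fin l => i.val < j ∧ a i = 1).card

/-- The number of zeros among the first `j` entries of a `0/1` sequence. -/
def zerosBefore {l : ℕ} (a : Fin l → Fin 2) (j : ℕ) : ℕ :=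
  (Finset.univ.filter fun i : Fin l => i.val < j ∧ a i = 0).card

section ZeroOneSequence

variable {l : ℕ} (a : Fin l → Fin 2)

theorem filter_lt_succ {j : ℕ} (hj : j < l) :
    (Finset.univ.filter fun i : Fin l => i.val < j + 1) =
      insert ⟨j, hj⟩ (Finset.univ.filter fun i : Fin l => i.val < j) := by
  ext i
  simp only [Finset.mem_filter, Finset.mem_univ, true_and, Finset.mem_insert, Fin.ext_iff]
  omega

theorem onesBefore_add_zerosBefore {j : ℕ} (hj : j ≤ l) :
    onesBefore a j + zerosBefore a j = j := by
  have h : (Finset.univ.filter fun i : Fin l => i.val < j).card = j := by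
    rw [Fin.card_filter_val_lt, min_eq_right hj]
  rw [onesBefore, zerosBefore, ← Finset.card_union_of_disjoint]
  · rw [← Finset.filter_or]
    conv_rhs => rw [← h]
    congr 1
    ext i
    have : a i = 1 ∨ a i = 0 := by
      generalize a i = b
      revert b
      decide
    simp only [Finset.mem_filter, Finset.mem_univ, true_and]
    tauto
  · rw [Finset.disjoint_filter]
    rintro i - ⟨-, h1⟩ ⟨-, h2⟩
    simp [h1] at h2

theorem onesBefore_mono : Monotone (onesBefore a) := fun _ _ h =>
  Finset.card_le_card fun i => by
    simp only [Finset.mem_filter, Finset.mem_univ, true_and]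
    exact fun hi => ⟨hi.1.trans_le h, hi.2⟩

@[simp]
theorem onesBefore_zero : onesBefore a 0 = 0 := by simp [onesBefore]

theorem onesBefore_succ {j : ℕ} (hj : j < l) :
    onesBefore a (j + 1) = onesBefore a j + if a ⟨j, hj⟩ = 1 then 1 else 0 := by
  simp only [onesBefore, ← Finset.filter_filter, filter_lt_succ hj, Finset.filter_insert]
  split_ifs with h
  · rw [Finset.card_insert_of_notMem (by simp)]
  · rfl

theorem onesBefore_length :
    onesBefore a l = (Finset.univ.filter fun i => a i = 1).card := by
  simp [onesBefore]

theorem isBallot_iff_onesBefore {k : ℕ} (hk : 1 ≤ k) :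
    IsBallot (k - 1) a ↔ ∀ j ≤ l, k * onesBefore a j ≤ j := by
  refine forall₂_congr fun j hj => ?_
  change (k - 1) * onesBefore a j ≤ zerosBefore a j ↔ _
  obtain ⟨m, rfl⟩ := Nat.exists_eq_add_of_le' hk
  have := onesBefore_add_zerosBefore a hj
  rw [Nat.add_sub_cancel, add_mul, one_mul]
  omega

/-- For a sequence of length `k n + k - 2` with `n` ones, the ballot condition need only be checked
on the initial strings of lengths `k - 1, 2 k - 1, …, n k - 1`. -/
theorem isBallot_iff_of_onesBefore_eq {k n : ℕ} (hk : 1 ≤ k) (hl : l = k * n + k - 1 - 1)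
    (ha : onesBefore a l = n) :
    IsBallot (k - 1) a ↔ ∀ t, 1 ≤ t → t ≤ n → onesBefore a (k * t - 1) + 1 ≤ t := by
  rw [isBallot_iff_onesBefore a hk]
  constructor
  · intro h t ht htn
    have h1 : k * t ≤ k * n := Nat.mul_le_mul_left k htn
    have h2 : k * 1 ≤ k * t := Nat.mul_le_mul_left k ht
    by_cases hl' : k * t - 1 ≤ l
    · have h3 := h (k * t - 1) hl'
      have h4 : k * onesBefore a (k * t - 1) < k * t := by omega
      exact Nat.lt_of_mul_lt_mul_left h4
    · exfalso
      have h3 := h l le_rfl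
      rw [ha] at h3
      omega
  · intro h j hj
    by_cases hjn : j < k * n
    · have h1 : j / k < n := Nat.div_lt_of_lt_mul hjn
      -- The first length of the form kt-1 that is at least j has t = j/k + 1.
      have h2 := h (j / k + 1) (Nat.le_add_left 1 _) h1
      have h3 : j < k * (j / k + 1) := Nat.lt_mul_div_succ j hk
      have h4 : onesBefore a j ≤ onesBefore a (k * (j / k + 1) - 1) :=
        onesBefore_mono a (by omega)
      calc k * onesBefore a j ≤ k * (j / k) := Nat.mul_le_mul_left k (by omega)
        _ ≤ j := Nat.mul_div_le j k
    · calc k * onesBefore a j ≤ k * n :=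
            Nat.mul_le_mul_left k ((onesBefore_mono a hj).trans ha.le)
        _ ≤ j := not_lt.mp hjn

end ZeroOneSequence

section LatticePath

variable {N : ℕ} (w : Equiv.Perm (Fin N))

theorem ad_eq_one_iff (i : Fin (N - 1)) :
    ad w i = 1 ↔ ¬ w ⟨i.val, by omega⟩ < w ⟨i.val + 1, by omega⟩ := by
  unfold ad
  split_ifs with h <;> simp [h]

theorem ad_eq_zero_iff (i : Fin (N - 1)) :
    ad w i = 0 ↔ w ⟨i.val, by omega⟩ < w ⟨i.val + 1, by omega⟩ := by
  unfold ad
  split_ifs with h <;> simp [h]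

theorem latticePath_apply (j : Fin (N - 1 + 1)) :
    latticePath w j = (zerosBefore (ad w) j, onesBefore (ad w) j) := by
  refine Prod.ext ?_ ?_
  · simp only [latticePath, Prod.fst_sum, apply_ite Prod.fst, zerosBefore, ad_eq_zero_iff]
    rw [← Finset.filter_filter, Finset.card_filter]
  · simp only [latticePath, Prod.snd_sum, apply_ite Prod.snd, onesBefore, ad_eq_one_iff]
    rw [← Finset.filter_filter, Finset.card_filter]
    refine Finset.sum_congr rfl fun i _ => ?_
    split_ifs <;> rfl

theorem latticePath_succ (i : Fin (N - 1)) :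
    latticePath w i.succ = latticePath w i.castSucc +
      if w ⟨i.val, by omega⟩ < w ⟨i.val + 1, by omega⟩ then (1, 0) else (0, 1) := by
  simp only [latticePath, Fin.val_succ, Fin.val_castSucc]
  rw [filter_lt_succ i.isLt, Finset.sum_insert (by simp), add_comm]

theorem isDyckPath_latticePath_iff (m h : ℕ) :
    IsDyckPath m h (latticePath w) ↔
      IsBallot m (ad w) ∧ (Finset.univ.filter fun i => ad w i = 1).card = h := by
  rw [← onesBefore_length]
  constructor
  · intro H
    refine ⟨fun j hj => ?_, ?_⟩
    · have := H.below ⟨j, by omega⟩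
      rwa [latticePath_apply] at this
    · have := H.height
      rwa [latticePath_apply] at this
  · rintro ⟨hb, hh⟩
    refine ⟨by simp [latticePath]; rfl, fun i => ?_, ?_, fun j => ?_⟩
    · rw [latticePath_succ]
      split_ifs
      · exact Or.inl rfl
      · exact Or.inr rfl
    · rw [latticePath_apply]
      exact hh
    · rw [latticePath_apply]
      exact hb j (by omega)

end LatticePath

open MeasureTheory

/-! ### Chambers of the open unit cube -/

/-- A nonempty level set is a translate of the kernel, which is a proper subspace. -/
theorem volume_setOf_linearMap_eq {ι : Type*} [Fintype ι] (f : (ι → ℝ) →ₗ[ℝ] ℝ) (hf : f ≠ 0)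
    (c : ℝ) : volume {x | f x = c} = 0 := by
  rcases Set.eq_empty_or_nonempty {x | f x = c} with h | ⟨x₀, hx₀⟩
  · rw [h, measure_empty]
  · have h : {x | f x = c} = (fun x => x + -x₀) ⁻¹' (LinearMap.ker f : Set (ι → ℝ)) := by
      ext x
      rw [Set.mem_ofPred_eq] at hx₀
      simp [hx₀, ← sub_eq_add_neg, sub_eq_zero]
    rw [h, measure_preimage_add_right]
    exact Measure.addHaar_submodule _ _ (by rwa [Ne, LinearMap.ker_eq_top])

theorem volume_setOf_apply_eq {ι : Type*} [Fintype ι] (i : ι) (c : ℝ) :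
    volume {x : ι → ℝ | x i = c} = 0 := by
  classical
  refine volume_setOf_linearMap_eq (LinearMap.proj i) (fun h => ?_) c
  simpa using congrArg (fun f => f (Pi.single i 1)) h

theorem volume_setOf_sub_eq {ι : Type*} [Fintype ι] {i j : ι} (hij : i ≠ j) (c : ℝ) :
    volume {x : ι → ℝ | x i - x j = c} = 0 := by
  classical
  refine volume_setOf_linearMap_eq
    ((LinearMap.proj i : (ι → ℝ) →ₗ[ℝ] ℝ) - LinearMap.proj j) (fun h => ?_) c
  simpa [hij.symm] using congrArg (fun f => f (Pi.single i 1)) h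

section Chamber

variable {M : ℕ}

/-- The points of the open unit cube whose coordinates are ordered as the values of `w`. -/
def chamber (w : Equiv.Perm (Fin M)) : Set (Fin M → ℝ) :=
  {y | (∀ i, y i ∈ Set.Ioo (0 : ℝ) 1) ∧ ∀ i j, w i < w j → y i < y j}

theorem lt_iff_of_mem_chamber {w : Equiv.Perm (Fin M)} {y : Fin M → ℝ} (hy : y ∈ chamber w)
    (i j : Fin M) : w i < w j ↔ y i < y j := by
  refine ⟨hy.2 i j, fun h => ?_⟩
  by_contra hw
  rcases (not_lt.mp hw).lt_or_eq with hlt | heq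
  · exact h.not_gt (hy.2 _ _ hlt)
  · rw [w.injective heq] at h
    exact h.false

/-- Both permutations order the positions alike, so `w.symm.trans w'` is an order automorphism of a
finite chain, hence the identity. -/
theorem eq_of_mem_chamber {w w' : Equiv.Perm (Fin M)} {y : Fin M → ℝ} (hy : y ∈ chamber w)
    (hy' : y ∈ chamber w') : w = w' := by
  have h : ∀ i j, w i < w j ↔ w' i < w' j := fun i j =>
    (lt_iff_of_mem_chamber hy i j).trans (lt_iff_of_mem_chamber hy' i j).symm
  have hmono : StrictMono (w.symm.trans w') := fun i j hij => by
    simpa using (h (w.symm i) (w.symm j)).mp (by simpa using hij)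
  have := congrArg (fun e : Fin M ≃o Fin M => e.toEquiv)
    (Subsingleton.elim (hmono.orderIsoOfSurjective _ (w.symm.trans w').surjective)
      (OrderIso.refl _))
  ext i
  have hi := congrArg (fun e : Equiv.Perm (Fin M) => e (w i)) this
  simp at hi
  rw [← hi]

theorem exists_mem_chamber {y : Fin M → ℝ} (h01 : ∀ i, y i ∈ Set.Ioo (0 : ℝ) 1)
    (hinj : Function.Injective y) : ∃ w, y ∈ chamber w := by
  -- `Tuple.sort y` takes ranks to positions; the chamber is indexed by the ranks of the positions.
  refine ⟨(Tuple.sort y).symm, h01, fun i j hij => ?_⟩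
  have := Tuple.monotone_sort y hij.le
  simp only [Function.comp_apply, Equiv.apply_symm_apply] at this
  refine this.lt_of_ne fun he => ?_
  rw [hinj he] at hij
  exact hij.false

theorem measurableSet_chamber (w : Equiv.Perm (Fin M)) : MeasurableSet (chamber w) := by
  have h : chamber w = (Set.univ.pi fun _ => Set.Ioo 0 1) ∩
      ⋂ (i : Fin M) (j : Fin M) (_ : w i < w j), {y : Fin M → ℝ | y i < y j} := by
    ext y
    simp [chamber]
  rw [h]
  exact (MeasurableSet.pi Set.countable_univ fun _ _ => measurableSet_Ioo).inter
    (MeasurableSet.iInter fun i => MeasurableSet.iInter fun j => MeasurableSet.iInter fun _ =>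
      measurableSet_lt (measurable_pi_apply i) (measurable_pi_apply j))

theorem volume_chamber_eq_one (w : Equiv.Perm (Fin M)) :
    volume (chamber w) = volume (chamber (1 : Equiv.Perm (Fin M))) := by
  have h := volume_measurePreserving_piCongrLeft (fun _ : Fin M => ℝ) w
  rw [← h.measure_preimage (measurableSet_chamber 1).nullMeasurableSet]
  congr 1
  have key : ∀ (y : Fin M → ℝ) i,
      MeasurableEquiv.piCongrLeft (fun _ : Fin M => ℝ) w y i = y (w.symm i) := by
    intro y i
    obtain ⟨i, rfl⟩ := w.surjective i
    rw [MeasurableEquiv.coe_piCongrLeft, Equiv.piCongrLeft_apply_apply, Equiv.symm_apply_apply]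
  ext y
  simp only [chamber, Set.mem_preimage, Set.mem_ofPred_eq, key, Equiv.Perm.one_apply]
  refine and_congr ?_ ?_
  · exact ⟨fun H i => H _, fun H i => by simpa using H (w i)⟩
  · constructor
    · intro H i j hij
      exact H _ _ (by simpa using hij)
    · intro H i j hij
      simpa using H (w i) (w j) hij

theorem volume_setOf_not_injective : volume {y : Fin M → ℝ | ¬ Function.Injective y} = 0 := by
  have : {y : Fin M → ℝ | ¬ Function.Injective y} ⊆
      ⋃ (i : Fin M) (j : Fin M) (_ : i ≠ j), {y | y i - y j = 0} := by
    intro y hy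
    simp only [Function.Injective, Set.mem_ofPred_eq, not_forall] at hy
    obtain ⟨i, j, he, hne⟩ := hy
    simp only [Set.mem_iUnion]
    exact ⟨i, j, hne, sub_eq_zero.mpr he⟩
  refine measure_mono_null this ?_
  simp only [measure_iUnion_null_iff]
  exact fun i j hij => volume_setOf_sub_eq hij 0

/-- The M! chambers are disjoint, have equal volume by permuting coordinates, and miss only points
of the open unit cube with a repeated coordinate. -/
theorem factorial_mul_volume_chamber (w : Equiv.Perm (Fin M)) :
    (M ! : ℝ≥0∞) * volume (chamber w) = 1 := by
  have hcube : volume (Set.univ.pi fun _ : Fin M => Set.Ioo (0 : ℝ) 1) = 1 := by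
    simp [Real.volume_pi_Ioo]
  have hunion : volume (⋃ w : Equiv.Perm (Fin M), chamber w) = 1 := by
    rw [← hcube]
    refine le_antisymm (measure_mono ?_) ?_
    · exact Set.iUnion_subset fun w y hy i _ => hy.1 i
    · refine (measure_mono (t := (⋃ w : Equiv.Perm (Fin M), chamber w) ∪
        {y | ¬ Function.Injective y}) fun y hy => ?_).trans ((measure_union_le _ _).trans ?_)
      · by_cases hinj : Function.Injective y
        · exact Or.inl (Set.mem_iUnion.mpr
            (exists_mem_chamber (fun i => hy i (Set.mem_univ i)) hinj))
        · exact Or.inr hinj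
      · rw [volume_setOf_not_injective, add_zero]
  rw [measure_iUnion (fun w w' hne => Set.disjoint_left.mpr fun y hy hy' =>
    hne (eq_of_mem_chamber hy hy')) measurableSet_chamber, tsum_fintype,
    Finset.sum_congr rfl fun w' _ => (volume_chamber_eq_one w').trans (volume_chamber_eq_one w).symm,
    Finset.sum_const, Finset.card_univ, Fintype.card_perm, Fintype.card_fin, nsmul_eq_mul] at hunion
  exact hunion

end Chamber

/-! ### Partial sums -/

section PartialSum

variable {M : ℕ}

/-- The sum of the first `j` coordinates. -/
def partialSum (x : Fin M → ℝ) (j : ℕ) : ℝ := ∑ i with i.val < j, x i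

@[simp]
theorem partialSum_zero (x : Fin M → ℝ) : partialSum x 0 = 0 := by simp [partialSum]

theorem partialSum_succ (x : Fin M → ℝ) {j : ℕ} (hj : j < M) :
    partialSum x (j + 1) = partialSum x j + x ⟨j, hj⟩ := by
  rw [partialSum, filter_lt_succ hj, Finset.sum_insert (by simp), add_comm, partialSum]

theorem partialSum_length (x : Fin M → ℝ) : partialSum x M = ∑ i, x i := by
  simp [partialSum]

variable (M) in
/-- The linear map taking `x` to `(x_1, x_1 + x_2, …, x_1 + ⋯ + x_M)`. -/
noncomputable def partialSums : (Fin M → ℝ) →ₗ[ℝ] (Fin M → ℝ) :=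
  Matrix.toLin' (Matrix.of fun i j : Fin M => if j ≤ i then (1 : ℝ) else 0)

theorem partialSums_apply (x : Fin M → ℝ) (i : Fin M) :
    partialSums M x i = partialSum x (i + 1) := by
  simp only [partialSums, Matrix.toLin'_apply, Matrix.mulVec, dotProduct, Matrix.of_apply, ite_mul,
    one_mul, zero_mul, partialSum, Finset.sum_filter, Nat.lt_succ_iff, Fin.le_def]

theorem det_partialSums : LinearMap.det (partialSums M) = 1 := by
  rw [partialSums, LinearMap.det_toLin', Matrix.det_of_isLowerTriangular]
  · simp
  · intro i j hij
    have : ¬ j ≤ i := not_le.mpr (by simpa using hij)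
    simp [this]

theorem volume_preimage_partialSums (s : Set (Fin M → ℝ)) :
    volume (partialSums M ⁻¹' s) = volume s := by
  rw [Measure.addHaar_preimage_linearMap _ (by simp [det_partialSums]), det_partialSums]
  simp

end PartialSum

/-! ### The cells of the cube -/

section Cell

variable {M : ℕ}

/-- The points `x` such that `x_1 + ⋯ + x_j` is, for all `j`, the number of descents of `w` before
the position `j` plus the `j`-th coordinate of a point of the chamber of `w`. -/
def cell (w : Equiv.Perm (Fin M)) : Set (Fin M → ℝ) :=
  {x | (partialSums M x + -fun i : Fin M => (onesBefore (ad w) i : ℝ)) ∈ chamber w}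

theorem cell_eq_preimage (w : Equiv.Perm (Fin M)) :
    cell w = partialSums M ⁻¹' ((fun y => y + -fun i : Fin M => (onesBefore (ad w) i : ℝ)) ⁻¹'
      chamber w) := rfl

theorem measurableSet_cell (w : Equiv.Perm (Fin M)) : MeasurableSet (cell w) := by
  rw [cell_eq_preimage]
  exact (LinearMap.continuous_of_finiteDimensional (partialSums M)).measurable
    ((measurable_add_const _) (measurableSet_chamber w))

theorem factorial_mul_volume_cell (w : Equiv.Perm (Fin M)) :
    (M ! : ℝ≥0∞) * volume (cell w) = 1 := by
  rw [cell_eq_preimage, volume_preimage_partialSums, measure_preimage_add_right,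
    factorial_mul_volume_chamber]

theorem onesBefore_ad_succ (w : Equiv.Perm (Fin M)) {j : ℕ} (hj : j + 1 < M) :
    onesBefore (ad w) (j + 1) =
      onesBefore (ad w) j + if w ⟨j, by omega⟩ < w ⟨j + 1, hj⟩ then 0 else 1 := by
  rw [onesBefore_succ _ (by omega : j < M - 1)]
  simp only [ad_eq_one_iff, ite_not]

theorem mem_chamber_of_mem_cell {w : Equiv.Perm (Fin M)} {x : Fin M → ℝ} (hx : x ∈ cell w) :
    (fun i : Fin M => Int.fract (partialSum x (i + 1))) ∈ chamber w := by
  convert show _ ∈ chamber w from hx using 1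
  ext i
  have h : partialSums M x i - onesBefore (ad w) i ∈ Set.Ioo (0 : ℝ) 1 := by
    simpa [sub_eq_add_neg] using hx.1 i
  rw [partialSums_apply] at h
  rw [Int.fract_eq_iff]
  refine ⟨?_, ?_, onesBefore (ad w) i, ?_⟩ <;>
  simp only [Pi.add_apply, Pi.neg_apply, partialSums_apply, Int.cast_natCast] <;>
  linarith [h.1, h.2]

theorem floor_partialSum_of_mem_cell {w : Equiv.Perm (Fin M)} {x : Fin M → ℝ} (hx : x ∈ cell w)
    (i : Fin M) : ⌊partialSum x (i + 1)⌋ = onesBefore (ad w) i := by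
  have h : partialSums M x i - onesBefore (ad w) i ∈ Set.Ioo (0 : ℝ) 1 := by
    simpa [sub_eq_add_neg] using hx.1 i
  rw [partialSums_apply] at h
  rw [Int.floor_eq_iff, Int.cast_natCast]
  constructor <;> linarith [h.1, h.2]

theorem disjoint_cell {w w' : Equiv.Perm (Fin M)} (h : w ≠ w') : Disjoint (cell w) (cell w') :=
  Set.disjoint_left.mpr fun _ hx hx' =>
    h (eq_of_mem_chamber (mem_chamber_of_mem_cell hx) (mem_chamber_of_mem_cell hx'))

/-- A coordinate after the first is a difference of two chamber coordinates at an ascent, and one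
plus such a difference, now negative, at a descent. -/
theorem mem_Ioo_of_mem_cell {w : Equiv.Perm (Fin M)} {x : Fin M → ℝ} (hx : x ∈ cell w)
    (i : Fin M) : x i ∈ Set.Ioo (0 : ℝ) 1 := by
  obtain ⟨h01, hlt⟩ := hx
  have hpos : ∀ i : Fin M, 0 < partialSum x (i.val + 1) - onesBefore (ad w) i ∧
      partialSum x (i.val + 1) - onesBefore (ad w) i < 1 := fun i => by
    simpa [partialSums_apply, sub_eq_add_neg] using h01 i
  have hord : ∀ i j, w i < w j → partialSum x (i.val + 1) - onesBefore (ad w) i <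
      partialSum x (j.val + 1) - onesBefore (ad w) j := fun i j hij => by
    simpa only [Pi.add_apply, Pi.neg_apply, partialSums_apply, sub_eq_add_neg] using hlt i j hij
  obtain ⟨i, hi⟩ := i
  cases i with
  | zero => simpa [partialSum_succ x hi] using hpos ⟨0, hi⟩
  | succ j =>
    have h1 := hpos ⟨j, by omega⟩
    have h2 := hpos ⟨j + 1, hi⟩
    have h3 := hord ⟨j, by omega⟩ ⟨j + 1, hi⟩
    have h4 := hord ⟨j + 1, hi⟩ ⟨j, by omega⟩
    simp only [partialSum_succ x hi, onesBefore_ad_succ w hi] at h1 h2 h3 h4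
    split_ifs at h1 h2 h3 h4 with hw
    · have := h3 hw
      push_cast at this h2
      constructor <;> linarith
    · have hne : w ⟨j + 1, hi⟩ ≠ w ⟨j, by omega⟩ := fun h => by simpa using w.injective h
      have := h4 (lt_of_le_of_ne (not_lt.mp hw) hne)
      push_cast at this h2
      constructor <;> linarith

/-- Adding a number in [0,1] keeps the floor if the fractional part grows and raises it by one if
the fractional part drops. -/
theorem floor_partialSum_eq_of_mem_chamber {w : Equiv.Perm (Fin M)} {x : Fin M → ℝ}
    (hx : ∀ i, 0 ≤ x i ∧ x i ≤ 1)
    (hw : (fun i : Fin M => Int.fract (partialSum x (i + 1))) ∈ chamber w) :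
    ∀ j : ℕ, j < M → ⌊partialSum x (j + 1)⌋ = onesBefore (ad w) j
  | 0, hj => by
    have h := (hw.1 ⟨0, hj⟩).1
    simp only [partialSum_succ x hj, partialSum_zero, zero_add, onesBefore_zero] at h ⊢
    -- The value 1 would have fractional part 0, outside the open cube.
    have h1 : x ⟨0, hj⟩ ≠ 1 := fun h1 => by simp [h1] at h
    rw [Int.floor_eq_iff]
    have := hx ⟨0, hj⟩
    exact ⟨by simpa using this.1, by simpa using this.2.lt_of_ne h1⟩
  | j + 1, hj => by
    have ih := floor_partialSum_eq_of_mem_chamber hx hw j (by omega)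
    have hlt := lt_iff_of_mem_chamber hw ⟨j, by omega⟩ ⟨j + 1, hj⟩
    have hx' := hx ⟨j + 1, hj⟩
    have h1 := hw.1 ⟨j, by omega⟩
    have h2 := hw.1 ⟨j + 1, hj⟩
    simp only [Set.mem_Ioo] at hlt h1 h2
    have e1 := Int.floor_add_fract (partialSum x (j + 1))
    have e2 := Int.floor_add_fract (partialSum x (j + 1 + 1))
    have e3 := partialSum_succ x hj
    rw [onesBefore_ad_succ w hj]
    rw [ih] at e1
    push_cast at e1 ⊢
    split_ifs with h
    · rw [hlt] at h
      have a1 : (⌊partialSum x (j + 1 + 1)⌋ : ℝ) < ((onesBefore (ad w) j + 1 : ℤ) : ℝ) := by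
        push_cast
        linarith
      have a2 : (((onesBefore (ad w) j : ℤ) - 1 : ℤ) : ℝ) < (⌊partialSum x (j + 1 + 1)⌋ : ℝ) := by
        push_cast
        linarith
      have a1 := Int.cast_lt.mp a1
      have a2 := Int.cast_lt.mp a2
      omega
    · have hne : w ⟨j, by omega⟩ ≠ w ⟨j + 1, hj⟩ := fun h => by simpa using w.injective h
      have h' := (lt_iff_of_mem_chamber hw ⟨j + 1, hj⟩ ⟨j, by omega⟩).mp
        (lt_of_le_of_ne (not_lt.mp h) hne.symm)
      simp only at h'
      have a1 : (⌊partialSum x (j + 1 + 1)⌋ : ℝ) < ((onesBefore (ad w) j + 2 : ℤ) : ℝ) := by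
        push_cast
        linarith
      have a2 : ((onesBefore (ad w) j : ℤ) : ℝ) < (⌊partialSum x (j + 1 + 1)⌋ : ℝ) := by
        push_cast
        linarith
      have a1 := Int.cast_lt.mp a1
      have a2 := Int.cast_lt.mp a2
      omega

theorem exists_mem_cell {x : Fin M → ℝ} (hx : ∀ i, 0 ≤ x i ∧ x i ≤ 1)
    (h0 : ∀ i : Fin M, Int.fract (partialSum x (i + 1)) ≠ 0)
    (hinj : Function.Injective fun i : Fin M => Int.fract (partialSum x (i + 1))) :
    ∃ w, x ∈ cell w := by
  obtain ⟨w, hw⟩ := exists_mem_chamber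
    (fun i => ⟨(Int.fract_nonneg _).lt_of_ne (h0 i).symm, Int.fract_lt_one _⟩) hinj
  refine ⟨w, ?_⟩
  change _ ∈ chamber w
  convert hw using 1
  ext i
  have := floor_partialSum_eq_of_mem_chamber hx hw i i.isLt
  rw [Int.fract, this]
  simp [partialSums_apply, sub_eq_add_neg]

/-- The points two of whose partial sums, including the empty one, differ by an integer. -/
def exceptionalSet (M : ℕ) : Set (Fin M → ℝ) :=
  {x | ¬ ((∀ i : Fin M, Int.fract (partialSum x (i + 1)) ≠ 0) ∧
    Function.Injective fun i : Fin M => Int.fract (partialSum x (i + 1)))}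

/-- In the coordinates given by partial sums, the set lies in countably many hyperplanes. -/
theorem volume_exceptionalSet : volume (exceptionalSet M) = 0 := by
  have : exceptionalSet M ⊆ partialSums M ⁻¹'
      ((⋃ (i : Fin M) (c : ℤ), {y | y i = c}) ∪
        ⋃ (i : Fin M) (j : Fin M) (_ : i ≠ j) (c : ℤ), {y | y i - y j = c}) := by
    intro x hx
    rw [exceptionalSet, Set.mem_ofPred_eq, not_and_or] at hx
    simp only [Set.mem_preimage, Set.mem_union, Set.mem_iUnion, Set.mem_ofPred_eq,
      partialSums_apply]
    refine hx.imp (fun h => ?_) (fun h => ?_)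
    · push Not at h
      obtain ⟨i, hi⟩ := h
      exact ⟨i, ⌊partialSum x (i + 1)⌋, by
        linarith [Int.floor_add_fract (partialSum x (i.val + 1))]⟩
    · simp only [Function.Injective, not_forall] at h
      obtain ⟨i, j, he, hne⟩ := h
      obtain ⟨c, hc⟩ := Int.fract_eq_fract.mp he
      exact ⟨i, j, hne, c, hc⟩
  refine measure_mono_null this ?_
  rw [volume_preimage_partialSums]
  refine measure_union_null ?_ ?_
  · simp only [measure_iUnion_null_iff]
    exact fun i c => volume_setOf_apply_eq i c
  · simp only [measure_iUnion_null_iff]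
    exact fun i j hij c => volume_setOf_sub_eq hij c

end Cell

/-! ### The projected polytope -/

section Polytope

/-- The projection of `P_{k,n}` to all coordinates but the last. -/
def projectedPolytope (k n M : ℕ) : Set (Fin M → ℝ) :=
  {x | (∀ i, 0 ≤ x i ∧ x i ≤ 1) ∧ n ≤ ∑ i, x i ∧ ∑ i, x i ≤ n + 1 ∧
    ∀ t : ℕ, 1 ≤ t → t ≤ n → partialSum x (k * t) ≤ t}

/-- The last coordinate is n+1 minus the others, so its bounds 0 and 1 become bounds on their sum;
the constraints with t ≤ n do not involve it. -/
theorem dropLast_image_eq {k n N : ℕ} (hN : k * (n + 1) = N + 1) :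
    dropLast (N + 1) '' {x | x ∈ hypersimplex (n + 1) (N + 1) ∧
      ∀ t : ℕ, 1 ≤ t → t ≤ n → ∑ i with i.val < k * t, x i ≤ t} = projectedPolytope k n N := by
  have hkt : ∀ t ≤ n, k * t ≤ N := by
    intro t ht
    have hk : 0 < k := Nat.pos_of_ne_zero (by rintro rfl; simp at hN)
    have := Nat.mul_le_mul_left k ht
    rw [mul_add] at hN
    omega
  have hsum : ∀ (x : Fin (N + 1) → ℝ) (t : ℕ), t ≤ n →
      ∑ i with i.val < k * t, x i = partialSum (fun i : Fin N => x i.castSucc) (k * t) := by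
    intro x t ht
    rw [partialSum, Finset.sum_filter, Finset.sum_filter, Fin.sum_univ_castSucc]
    simp [(hkt t ht).not_gt]
  refine Set.ext fun (y : Fin N → ℝ) => ?_
  constructor
  · rintro ⟨x, ⟨⟨h01, hs⟩, ht⟩, rfl⟩
    have hs' : ∑ i : Fin N, x i.castSucc + x (Fin.last N) = n + 1 := by
      rw [← Fin.sum_univ_castSucc, hs]
      push_cast
      rfl
    have hl := h01 (Fin.last N)
    refine ⟨fun i => h01 _, ?_, ?_, fun t h1 hn => ?_⟩
    · change (n : ℝ) ≤ ∑ i : Fin N, x i.castSucc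
      linarith
    · change ∑ i : Fin N, x i.castSucc ≤ (n : ℝ) + 1
      linarith
    · exact (hsum x t hn).symm.trans_le (ht t h1 hn)
  · rintro ⟨h01, hl, hu, ht⟩
    refine ⟨Fin.snoc (α := fun _ => ℝ) y (n + 1 - ∑ i, y i),
      ⟨⟨fun i => ?_, ?_⟩, fun t h1 hn => ?_⟩, ?_⟩
    · refine Fin.lastCases ?_ (fun i => ?_) i
      · rw [Fin.snoc_last]
        constructor <;> linarith
      · rw [Fin.snoc_castSucc]
        exact h01 i
    · rw [Fin.sum_univ_castSucc]
      simp
    · rw [hsum _ t hn]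
      simpa using ht t h1 hn
    · ext i
      exact Fin.snoc_castSucc (α := fun _ => ℝ) _ _ i

variable {k n M : ℕ}

/-- The permutations indexing the cells of the projected polytope. -/
def IsAdmissible (k n : ℕ) {M : ℕ} (w : Equiv.Perm (Fin M)) : Prop :=
  IsBallot (k - 1) (ad w) ∧ (Finset.univ.filter fun i => ad w i = 1).card = n

theorem mem_projectedPolytope_iff_of_mem_cell (hk : 1 ≤ k) (hM : M = k * n + k - 1)
    {w : Equiv.Perm (Fin M)} {x : Fin M → ℝ} (hx : x ∈ cell w) :
    x ∈ projectedPolytope k n M ↔ IsAdmissible k n w := by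
  have h01 : ∀ i, 0 ≤ x i ∧ x i ≤ 1 := fun i =>
    ⟨(mem_Ioo_of_mem_cell hx i).1.le, (mem_Ioo_of_mem_cell hx i).2.le⟩
  -- Partial sums on a cell are never integers, so being at most t means having floor at most t-1.
  have hfloor : ∀ j (hj : 1 ≤ j) (hjM : j ≤ M) (t : ℕ),
      (onesBefore (ad w) (j - 1) + 1 ≤ t ↔ partialSum x j ≤ t) ∧
      (t ≤ onesBefore (ad w) (j - 1) ↔ t ≤ partialSum x j) := by
    intro j hj hjM t
    obtain ⟨j, rfl⟩ := Nat.exists_eq_add_of_le' hj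
    have hf := floor_partialSum_of_mem_cell hx ⟨j, hjM⟩
    have hp := ((mem_chamber_of_mem_cell hx).1 ⟨j, hjM⟩).1
    simp only [Nat.add_sub_cancel] at hf hp ⊢
    have e := Int.floor_add_fract (partialSum x (j + 1))
    have hl := Int.fract_lt_one (partialSum x (j + 1))
    rw [hf, Int.cast_natCast] at e
    constructor
    · constructor
      · intro h
        have : (onesBefore (ad w) j : ℝ) + 1 ≤ t := by exact_mod_cast h
        linarith
      · intro h
        have : (onesBefore (ad w) j : ℝ) < t := by linarith
        exact_mod_cast this
    · constructor
      · intro h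
        have : (t : ℝ) ≤ onesBefore (ad w) j := by exact_mod_cast h
        linarith
      · intro h
        have : (t : ℝ) < (onesBefore (ad w) j + 1 : ℕ) := by
          push_cast
          linarith
        exact Nat.lt_succ_iff.mp (by exact_mod_cast this)
  have htotal : (n : ℝ) ≤ ∑ i, x i ∧ ∑ i, x i ≤ n + 1 ↔ onesBefore (ad w) (M - 1) = n := by
    rw [← partialSum_length]
    rcases Nat.eq_zero_or_pos M with h0 | hpos
    -- M = 0 forces k = 1 and n = 0; here M - 1 is truncated and both sides hold trivially.
    · have hn : n = 0 := by
        by_contra hn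
        have := Nat.mul_pos hk (Nat.pos_of_ne_zero hn)
        omega
      subst h0 hn
      simp
    · have h1 := (hfloor M hpos le_rfl (n + 1)).1
      have h2 := (hfloor M hpos le_rfl n).2
      push_cast at h1
      rw [← h1, ← h2]
      omega
  rw [IsAdmissible, ← onesBefore_length]
  constructor
  · rintro ⟨-, hl, hu, ht⟩
    have hn := htotal.mp ⟨hl, hu⟩
    refine ⟨(isBallot_iff_of_onesBefore_eq _ hk (by rw [hM]) hn).mpr fun t h1 h2 => ?_, hn⟩
    have h3 : k * t ≤ k * n := Nat.mul_le_mul_left k h2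
    have h4 : 0 < k * t := Nat.mul_pos hk h1
    exact (hfloor (k * t) h4 (by omega) t).1.mpr (ht t h1 h2)
  · rintro ⟨hb, hn⟩
    refine ⟨h01, (htotal.mpr hn).1, (htotal.mpr hn).2, fun t h1 h2 => ?_⟩
    have h3 : k * t ≤ k * n := Nat.mul_le_mul_left k h2
    have h4 : 0 < k * t := Nat.mul_pos hk h1
    exact (hfloor (k * t) h4 (by omega) t).1.mp
      ((isBallot_iff_of_onesBefore_eq _ hk (by rw [hM]) hn).mp hb t h1 h2)

theorem projectedPolytope_ae_eq (hk : 1 ≤ k) (hM : M = k * n + k - 1) :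
    projectedPolytope k n M =ᵐ[volume]
      ⋃ w : {w : Equiv.Perm (Fin M) // IsAdmissible k n w}, cell w.1 := by
  have hnull : ∀ᵐ x : Fin M → ℝ, x ∉ exceptionalSet M :=
    measure_eq_zero_iff_ae_notMem.mp volume_exceptionalSet
  filter_upwards [hnull] with x hx
  refine propext ?_
  change x ∈ projectedPolytope k n M ↔ x ∈ ⋃ w : {w : Equiv.Perm (Fin M) // _}, cell w.1
  rw [exceptionalSet, Set.mem_ofPred_eq, not_not] at hx
  rw [Set.mem_iUnion]
  constructor
  · intro hP
    obtain ⟨w, hw⟩ := exists_mem_cell hP.1 hx.1 hx.2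
    exact ⟨⟨w, (mem_projectedPolytope_iff_of_mem_cell hk hM hw).mp hP⟩, hw⟩
  · rintro ⟨⟨w, hadm⟩, hw⟩
    exact (mem_projectedPolytope_iff_of_mem_cell hk hM hw).mpr hadm

theorem factorial_mul_volume_projectedPolytope (hk : 1 ≤ k) (hM : M = k * n + k - 1) :
    (M ! : ℝ≥0∞) * volume (projectedPolytope k n M) =
      Nat.card {w : Equiv.Perm (Fin M) // IsAdmissible k n w} := by
  rw [measure_congr (projectedPolytope_ae_eq hk hM),
    measure_iUnion (fun w w' h => disjoint_cell (Subtype.coe_injective.ne h))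
      (fun w => measurableSet_cell w.1), ← ENNReal.tsum_mul_left]
  simp only [factorial_mul_volume_cell, ENNReal.tsum_const, mul_one, ENat.card_eq_coe_natCard,
    ENat.toENNReal_coe]

theorem normalizedVolume_polytopeP (hk : 1 ≤ k) :
    normalizedVolume (polytopeP k n) =
      Nat.card {w : Equiv.Perm (Fin (k * n + k - 1)) // IsAdmissible k n w} := by
  -- The dimensions are made variables so that N = M + 1 can be substituted in the types.
  have key : ∀ N M, k * (n + 1) = N → k * n + k - 1 = M →
      normalizedVolume {x | x ∈ hypersimplex (n + 1) N ∧
        ∀ t : ℕ, 1 ≤ t → t ≤ n → ∑ i with i.val < k * t, x i ≤ t} =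
      Nat.card {w : Equiv.Perm (Fin M) // IsAdmissible k n w} := by
    intro N M hN hM
    obtain rfl : N = M + 1 := by
      rw [← hN, mul_add]
      omega
    rw [normalizedVolume, dropLast_image_eq hN]
    exact factorial_mul_volume_projectedPolytope hk hM.symm
  exact key _ _ rfl rfl

end Polytope

end EulerianCatalan

theorem mainTheorem4 (k n : ℕ) (hk : 1 ≤ k) :
    EulerianCatalan.normalizedVolume (EulerianCatalan.polytopeP k n) =
        (Nat.card {w : Equiv.Perm (Fin (k * n + k - 1)) //
          EulerianCatalan.IsDyckPath (k - 1) n (EulerianCatalan.latticePath w)} : ℝ≥0∞) ∧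
      EulerianCatalan.normalizedVolume (EulerianCatalan.polytopeP k n) =
        (Nat.card {w : Equiv.Perm (Fin (k * n + k - 1)) //
          EulerianCatalan.IsBallot (k - 1) (EulerianCatalan.ad w) ∧
            (Finset.univ.filter fun i => EulerianCatalan.ad w i = 1).card = n} : ℝ≥0∞) := by
  refine ⟨?_, EulerianCatalan.normalizedVolume_polytopeP hk⟩
  simp only [EulerianCatalan.isDyckPath_latticePath_iff]
  exact EulerianCatalan.normalizedVolume_polytopeP hk
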